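/- **Arithmetic.** For $x\in\mathbb R$ let $d(x,\mathbb Z)$ be the distance from $x$ to the integers. For $\alpha\in\mathbb R\setminus\mathbb Q$, $\beta\in\mathbb R$ put $\alpha_0=d(\alpha,\mathbb Z)$, $\beta_0=d(\beta,\mathbb Z)$, $\alpha_{n+1}=d(1/\alpha_n,\mathbb Z)$, $\beta_{n+1}=d(\beta_n/\alpha_n,\mathbb Z)$, and choose integers $a_n$ and signs $\epsilon_n,\delta_n\in\{-1,1\}$ with $\alpha\in\epsilon_0\alpha_0+\mathbb Z$, $1/\alpha_n=a_n+\epsilon_{n+1}\alpha_{n+1}$, $\beta\in\delta_0\beta_0+\mathbb Z$, $\beta_n/\alpha_n\in\delta_{n+1}\beta_{n+1}+\mathbb Z$ ($n\ge 0$; where $\delta_n$ is not determined, i.e. $\beta_n\in\{0,1/2\}$, take $\delta_n=1$ if $\beta_n=0$ and $\delta_n=-1$ if $\beta_n=1/2$). Put $\alpha_{-1}=1$. Define $$\mathcal B(\alpha)=\sum_{n\ge0}\Big(\prod_{i<n}\alpha_i\Big)\log\frac1{\alpha_n},\qquad \mathcal B(\alpha,\beta)=\sum_{n\ge0}\Big(\prod_{i<n}\alpha_i\Big)\mathcal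 M(\alpha_n,\beta_n),\qquad \mathcal M(r,s)=\tfrac12\log\tfrac1r+\tfrac12\log\tfrac1{r+s},$$ both in $[0,\infty]$; $\alpha$ is a *Brjuno number* if $\mathcal B(\alpha)<\infty$. **Change of coordinates.** For $0<r<1/2$, $0\le s\le1/2$, $w=x+iy$, $y\ge-1$, let $g_r(w)=|e^{-3\pi r}-e^{-2\pi i r w}|$ and $$G(w)=G_{r,s}(w)=rx+\tfrac{i}{4\pi}\big(\log g_r(w+\tfrac12)+\log g_r(w-\tfrac sr+\tfrac12)\big),\qquad P(w)=rx+i\max\{\operatorname{Im}G(w),\operatorname{Im}G(-1+iy)\}.$$ Define $\tilde Y(w)$ as follows, all intervals for $x$ being understood modulo $\frac1r\mathbb Z$. If $s\ge r$: $\tilde Y(w)=G(w-\frac sr)+s$ on $(\frac sr-1,\frac sr-\frac12]$; $G(w)$ on $[\frac sr-\frac12,\frac sr)$ and on $(\frac1r-1,\frac1r-\frac12]$; $G(w+\frac sr)-s$ on $[\frac1r-\frac12,\frac1r)$; $P(w)$ otherwise. If $s<r$: $\tilde Y(w)=G(w-1)+r$ on $(0,\frac s{2r}]$; $G(w)$ on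 $[\frac s{2r},\frac sr)$ and on $(\frac1r-1,\frac1r-1+\frac s{2r}]$; $G(w+1)-r$ on $(\frac1r-1+\frac s{2r},\frac1r+\frac sr-1]$; $G(w-\frac sr)+s$ on $(\frac1r+\frac sr-1,\frac1r+\frac s{2r}-\frac12]$; $G(w+\frac sr)-s$ on $(\frac1r+\frac s{2r}-\frac12,\frac1r]$; $P(w)$ otherwise. Let $Y_{r,s}(w)=\tilde Y(w)-\tilde Y(0)$. For $n\ge0$ let $V_n(w)=Y_{\alpha_n,\beta_n}(w)$ if $\epsilon_n=\delta_n$ and $V_n(w)=Y_{\alpha_n,\beta_n}(w+\beta_n/\alpha_n)-\beta_n$ if $\epsilon_n\ne\delta_n$; let $\mathbb Y_n=V_n$ if $\epsilon_n=-1$ and $\mathbb Y_n=-\overline{V_n}$ if $\epsilon_n=1$. **Base functions.** For $n\ge-1$ let $I_n^0=\{w:0\le\operatorname{Re}w\le1/\alpha_n,\ \operatorname{Im}w\ge-1\}$. For $j\ge0$ put $I_{-1}^{j+1}=\mathbb Y_0(I_0^j)+\frac{\epsilon_0+1}2$ and, for $n\ge0$, with $K_{n}^j=\{w\in I_{n}^j:\operatorname{Re}w\le\frac1{\alpha_{n}}-1\}$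 and $J_{n}^j=\{w\in I_{n}^j:\operatorname{Re}w\ge\frac1{\alpha_{n}}-1\}$, $$I_n^{j+1}=\bigcup_{l=0}^{a_n-2}\big(\mathbb Y_{n+1}(I_{n+1}^j)+l\big)\cup\big(\mathbb Y_{n+1}(K_{n+1}^j)+a_n-1\big)\quad(\epsilon_{n+1}=-1),$$ $$I_n^{j+1}=\bigcup_{l=1}^{a_n}\big(\mathbb Y_{n+1}(I_{n+1}^j)+l\big)\cup\big(\mathbb Y_{n+1}(J_{n+1}^j)+a_n+1\big)\quad(\epsilon_{n+1}=+1).$$ For $x\in[0,1/\alpha_n]$ let $b_n^j(x)=\min\{y:x+iy\in I_n^j\}$ and $b_n(x)=\sup_j b_n^j(x)\in[-1,\infty]$ (the base functions). **Proposition.** There is a universal constant $C$ such that for all $\alpha\in\mathbb R\setminus\mathbb Q$ and $\beta\in\mathbb R$: 1. if $\alpha$ is a Brjuno number, then for every $n\ge-1$ both $\mathcal B(\alpha_{n+1},\beta_{n+1})$ and $\sup_{x\in[0,1/\alpha_n]}b_n(x)$ are finite, and $$\Big|\mathcal B(\alpha_{n+1},\beta_{n+1})-2\pi\sup_{x\in[0,1/\alpha_n]}b_n(x)\Big|\le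 C;$$ 2. for every $n\ge-1$, $\sup_{x\in[0,1/\alpha_n]}b_n(x)=\infty$ if and only if $\mathcal B(\alpha_{n+1},\beta_{n+1})=\infty$, and if and only if $\mathcal B(\alpha,\beta)=\infty$; 3. $\mathcal B(\alpha,\beta)=\infty$ if and only if $\alpha$ is not a Brjuno number. -/

import Mathlib

noncomputable section

namespace BiCritical

open Set Complex

/-! ### Arithmetic of the pair `(α, β)` -/

/-- The distance `d(x, ℤ)`. -/
def distInt (x : ℝ) : ℝ := |x - round x|

/-- The sign `σ ∈ {-1, 1}` with `x = round x + σ * d(x, ℤ)`. -/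
def signInt (x : ℝ) : ℤ := if (round x : ℝ) ≤ x then 1 else -1

/-- `distInt x` is the least distance from `x` to an integer. -/
theorem distInt_le (x : ℝ) (z : ℤ) : distInt x ≤ |x - z| := round_le x z

theorem round_add_signInt_mul_distInt (x : ℝ) :
    (round x : ℝ) + signInt x * distInt x = x := by
  unfold signInt distInt
  split_ifs with h
  · rw [abs_of_nonneg (by linarith)]; push_cast; ring
  · rw [abs_of_nonpos (by linarith)]; push_cast; ring

/-- `α₀ = d(α, ℤ)`, `αₙ₊₁ = d(1 / αₙ, ℤ)`. -/
def alphaSeq (α : ℝ) : ℕ → ℝ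
  | 0 => distInt α
  | n + 1 => distInt (1 / alphaSeq α n)

/-- `β₀ = d(β, ℤ)`, `βₙ₊₁ = d(βₙ / αₙ, ℤ)`. -/
def betaSeq (α β : ℝ) : ℕ → ℝ
  | 0 => distInt β
  | n + 1 => distInt (betaSeq α β n / alphaSeq α n)

/-- The signs `εₙ`: `α = a₋₁ + ε₀ α₀` and `1 / αₙ = aₙ + εₙ₊₁ αₙ₊₁`. -/
def epsSeq (α : ℝ) : ℕ → ℤ
  | 0 => signInt α
  | n + 1 => signInt (1 / alphaSeq α n)

/-- The integers `aₙ`, for `n ≥ 0`, with `1 / αₙ = aₙ + εₙ₊₁ αₙ₊₁`. -/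
def aSeq (α : ℝ) (n : ℕ) : ℤ := round (1 / alphaSeq α n)

/-- The signs `δₙ`: `β` is an integer plus `δ₀ β₀`, and `βₙ / αₙ` is an integer plus
`δₙ₊₁ βₙ₊₁`. -/
def deltaSeq (α β : ℝ) : ℕ → ℤ
  | 0 => signInt β
  | n + 1 => signInt (betaSeq α β n / alphaSeq α n)

/-- The Brjuno sum `𝓑(α) = ∑ₙ (α₀ ⋯ αₙ₋₁) log (1 / αₙ)`, with values in `[0, ∞]`
(its terms are nonnegative for irrational `α`). -/
def brjunoSum (α : ℝ) : ENNReal :=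
  ∑' n : ℕ, ENNReal.ofReal
    ((∏ i ∈ Finset.range n, alphaSeq α i) * Real.log (1 / alphaSeq α n))

/-- `α` is a Brjuno number. -/
def IsBrjuno (α : ℝ) : Prop := brjunoSum α < ⊤

/-- `𝓜(r, s) = (1/2) log (1 / r) + (1/2) log (1 / (s + r))`. -/
def bigM (r s : ℝ) : ℝ :=
  (1 / 2) * Real.log (1 / r) + (1 / 2) * Real.log (1 / (s + r))

/-- The modified Brjuno sum `𝓑(α, β) = ∑ₙ (α₀ ⋯ αₙ₋₁) 𝓜(αₙ, βₙ)`, with values in `[0, ∞]`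
(its terms are nonnegative for irrational `α`). -/
def modBrjunoSum (α β : ℝ) : ENNReal :=
  ∑' n : ℕ, ENNReal.ofReal
    ((∏ i ∈ Finset.range n, alphaSeq α i) * bigM (alphaSeq α n) (betaSeq α β n))

/-! ### The change of coordinates `Y_{r,s}` -/

/-- `g_r(w) = |e^{-3πr} - e^{-2πriw}|`. -/
def g (r : ℝ) (w : ℂ) : ℝ :=
  ‖Complex.exp (-3 * Real.pi * r) - Complex.exp (-2 * Real.pi * r * I * w)‖

/-- `G_{r,s}(w) = r Re w + (i/4π) (log g_r(w + 1/2) + log g_r(w - s/r + 1/2))`. -/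
def G (r s : ℝ) (w : ℂ) : ℂ :=
  ((r * w.re : ℝ) : ℂ) +
    ((1 / (4 * Real.pi) *
      (Real.log (g r (w + 1 / 2)) + Real.log (g r (w - s / r + 1 / 2))) : ℝ) : ℂ) * I

open Classical in
/-- `G_{r,s}` on each horizontal line, with its imaginary part cut off from below at the height
`Im G_{r,s}(-1 + iy)`; vertical lines are preserved. -/
def preY₁ (r s : ℝ) (w : ℂ) : ℂ :=
  if (G r s (-1 + w.im * I)).im ≤ (G r s w).im then G r s w
  else ((r * w.re : ℝ) : ℂ) + ((G r s (-1 + w.im * I)).im : ℂ) * I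

/-- The set `S + (1/r) ℤ`. -/
def periodize (r : ℝ) (S : Set ℝ) : Set ℝ := {x | ∃ k : ℤ, x - k / r ∈ S}

open Classical in
/-- The piecewise modification of `G_{r,s}` near the two marked lines `Re w ∈ (1/r) ℤ` and
`Re w ∈ s/r + (1/r) ℤ`. -/
def preY₂ (r s : ℝ) (w : ℂ) : ℂ :=
  if r ≤ s then
    if w.re ∈ periodize r (Ioc (s / r - 1) (s / r - 1 / 2)) then G r s (w - s / r) + s
    else if w.re ∈ periodize r (Ico (s / r - 1 / 2) (s / r)) then G r s w
    else if w.re ∈ periodize r (Ioc (1 / r - 1) (1 / r - 1 / 2)) then G r s w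
    else if w.re ∈ periodize r (Ico (1 / r - 1 / 2) (1 / r)) then G r s (w + s / r) - s
    else preY₁ r s w
  else
    if w.re ∈ periodize r (Ioc 0 (s / (2 * r))) then G r s (w - 1) + r
    else if w.re ∈ periodize r (Ico (s / (2 * r)) (s / r)) then G r s w
    else if w.re ∈ periodize r (Ioc (1 / r - 1) (1 / r - 1 + s / (2 * r))) then G r s w
    else if w.re ∈ periodize r (Ioc (1 / r - 1 + s / (2 * r)) (1 / r + s / r - 1)) then
      G r s (w + 1) - r
    else if w.re ∈ periodize r (Ioc (1 / r + s / r - 1) (1 / r + s / (2 * r) - 1 / 2)) then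
      G r s (w - s / r) + s
    else if w.re ∈ periodize r (Ioc (1 / r + s / (2 * r) - 1 / 2) (1 / r)) then
      G r s (w + s / r) - s
    else preY₁ r s w

/-- The bi-critical change of coordinates `Y_{r,s}`. -/
def Y (r s : ℝ) (w : ℂ) : ℂ := preY₂ r s w - preY₂ r s 0

/-- `Y_{r,s}` when the second marked point is on the right of `0` (`right = true`), and its
conjugate by the translation that exchanges the two marked points, otherwise. -/
def Yside (r s : ℝ) (right : Bool) (w : ℂ) : ℂ :=
  if right then Y r s w else Y r s (w + s / r) - s

/-- The `n`-th change of coordinates `Yₙ`, for `n ≥ 0`. It is `Y_{αₙ,βₙ}` if `εₙ = δₙ`, and its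
conjugate by the translation if `εₙ ≠ δₙ`; if `εₙ = 1`, it is moreover followed by the reflection
`w ↦ -conj w`. -/
def Yn (α β : ℝ) (n : ℕ) (w : ℂ) : ℂ :=
  let v := Yside (alphaSeq α n) (betaSeq α β n)
    (decide (epsSeq α n = deltaSeq α β n)) w
  if epsSeq α n = -1 then v else -(starRingEnd ℂ v)

/-! ### The sets `Iₙʲ` and the base functions

The levels `n = -1, 0, 1, …` are indexed by `m = n + 1 : ℕ`. -/

/-- `1 / α_{m-1}`, with the convention `α₋₁ = 1`. -/
def width (α : ℝ) : ℕ → ℝ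
  | 0 => 1
  | n + 1 => 1 / alphaSeq α n

/-- `levelSet α β j m` is the set `I^j_{m-1}`.
`Iₙ⁰` is the half-strip `0 ≤ Re w ≤ 1 / αₙ`, `Im w ≥ -1`. For `n ≥ 0`, `Iₙʲ⁺¹` is tiled by integer
translates of `Yₙ₊₁(Iʲₙ₊₁)` and one integer translate of the image under `Yₙ₊₁` of the part
`Kʲₙ₊₁ : Re w ≤ 1 / αₙ₊₁ - 1` (if `εₙ₊₁ = -1`) or `Jʲₙ₊₁ : Re w ≥ 1 / αₙ₊₁ - 1` (if `εₙ₊₁ = 1`)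
of `Iʲₙ₊₁`. Finally `I₋₁ʲ⁺¹ = Y₀(I₀ʲ) + (ε₀ + 1) / 2`. -/
def levelSet (α β : ℝ) : ℕ → ℕ → Set ℂ
  | 0, m => {w | w.re ∈ Icc 0 (width α m) ∧ -1 ≤ w.im}
  | j + 1, 0 => (fun w => Yn α β 0 w + ((epsSeq α 0 : ℂ) + 1) / 2) '' levelSet α β j 1
  | j + 1, n + 1 =>
    if epsSeq α (n + 1) = -1 then
      (⋃ l ∈ Icc (0 : ℤ) (aSeq α n - 2),
        (fun w => Yn α β (n + 1) w + (l : ℂ)) '' levelSet α β j (n + 2)) ∪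
      (fun w => Yn α β (n + 1) w + ((aSeq α n : ℂ) - 1)) ''
        {w ∈ levelSet α β j (n + 2) | w.re ∈ Icc 0 (1 / alphaSeq α (n + 1) - 1)}
    else
      (⋃ l ∈ Icc (1 : ℤ) (aSeq α n),
        (fun w => Yn α β (n + 1) w + (l : ℂ)) '' levelSet α β j (n + 2)) ∪
      (fun w => Yn α β (n + 1) w + ((aSeq α n : ℂ) + 1)) ''
        {w ∈ levelSet α β j (n + 2) |
          w.re ∈ Icc (1 / alphaSeq α (n + 1) - 1) (1 / alphaSeq α (n + 1))}

/-- `baseFunApprox α β j m` is the function `b^j_{m-1}(x) = min {y | x + iy ∈ I^j_{m-1}}`. -/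
def baseFunApprox (α β : ℝ) (j m : ℕ) (x : ℝ) : EReal :=
  sInf ((fun y : ℝ => (y : EReal)) '' {y : ℝ | (x : ℂ) + y * I ∈ levelSet α β j m})

/-- `baseFun α β m` is the base function `b_{m-1} = sup_j b^j_{m-1}`, with values in
`[-1, ∞]` on `[0, 1 / α_{m-1}]`. -/
def baseFun (α β : ℝ) (m : ℕ) (x : ℝ) : EReal := ⨆ j : ℕ, baseFunApprox α β j m x

/-- `supBase α β m` is the supremum of the base function `b_{m-1}` over `[0, 1 / α_{m-1}]`. -/
def supBase (α β : ℝ) (m : ℕ) : EReal := ⨆ x ∈ Icc (0 : ℝ) (width α m), baseFun α β m x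

end BiCritical

end

namespace BiCritical

open Complex

/-! The map `Yn` scales real parts by ±r, r = αₘ, and its heights obey a nearly affine law. Up to a
universal constant, Im Y(w) is at most r max(Im w, 0) + 𝓜(r, s)/2π; it is at least r Im w + 𝓜(r,
s)/2π once r Im w ≥ 1/2, and at least 𝓜(r, s)/2π on one vertical line far from both marked lines
(`exists_Yside_im_estimates`). The term 𝓜/2π comes from the normalisation Y(0) = 0: before it, the
height at 0 is (1/4π) times the logarithm of a product of two factors comparable to r and r + s
(`exists_abs_preY₂_zero_im_add_bigM_le`).

The partial sums of 𝓑(αₘ, βₘ) obey the matching recursion: αₘ times the next sum, plus 𝓜(αₘ, βₘ). As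
αₘ < 1/2, errors contract geometrically from level to level. The upper bound passes through the
tiling over every x. For the lower bound one point per level suffices: the image of the extremal
point of the next level if the sum there is large, and otherwise a point coming from the good
vertical line (`exists_levelSet_estimates`).

Finally ½ log(1/r) ≤ 𝓜(r, s) ≤ log(1/r), so divergence does not depend on β. -/

/-! ### Size of the factors g_r -/

theorem g_sq (r : ℝ) (w : ℂ) :
    g r w ^ 2 = Real.exp (-3 * Real.pi * r) ^ 2 + Real.exp (2 * Real.pi * r * w.im) ^ 2 -
      2 * Real.exp (-3 * Real.pi * r) * Real.exp (2 * Real.pi * r * w.im) *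
        Real.cos (2 * Real.pi * r * w.re) := by
  have h1 : Complex.exp (-3 * Real.pi * r) = (Real.exp (-3 * Real.pi * r) : ℂ) := by
    push_cast; rfl
  have h2 : -2 * Real.pi * r * I * w =
      ((2 * Real.pi * r * w.im : ℝ) : ℂ) + ((-(2 * Real.pi * r * w.re) : ℝ) : ℂ) * I := by
    apply Complex.ext <;> simp
  unfold g
  rw [h1, h2, Complex.sq_norm, Complex.normSq_apply]
  simp only [sub_re, sub_im, Complex.exp_re, Complex.exp_im, ofReal_re, ofReal_im, add_re, add_im,
    mul_re, mul_im, I_re, I_im, mul_zero, mul_one, sub_zero, zero_add, add_zero, zero_sub,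
    Real.cos_neg, Real.sin_neg]
  linear_combination Real.exp (2 * Real.pi * r * w.im) ^ 2 *
    Real.sin_sq_add_cos_sq (2 * Real.pi * r * w.re)

theorem g_nonneg (r : ℝ) (w : ℂ) : 0 ≤ g r w := norm_nonneg _

theorem g_le (r : ℝ) (w : ℂ) :
    g r w ≤ Real.exp (-3 * Real.pi * r) + Real.exp (2 * Real.pi * r * w.im) := by
  refine abs_le_of_sq_le_sq' ?_ (by positivity) |>.2
  rw [g_sq]
  nlinarith [Real.neg_one_le_cos (2 * Real.pi * r * w.re),
    mul_pos (Real.exp_pos (-3 * Real.pi * r)) (Real.exp_pos (2 * Real.pi * r * w.im))]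

theorem sub_le_g (r : ℝ) (w : ℂ) :
    Real.exp (2 * Real.pi * r * w.im) - Real.exp (-3 * Real.pi * r) ≤ g r w := by
  refine abs_le_of_sq_le_sq' ?_ (g_nonneg r w) |>.2
  rw [g_sq]
  nlinarith [Real.cos_le_one (2 * Real.pi * r * w.re),
    mul_pos (Real.exp_pos (-3 * Real.pi * r)) (Real.exp_pos (2 * Real.pi * r * w.im))]

/-- The two points then make an angle of at least π/2 at the origin, so their distance is at least
either modulus. -/
theorem exp_le_g_of_cos_nonpos {r : ℝ} {w : ℂ} (h : Real.cos (2 * Real.pi * r * w.re) ≤ 0) :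
    Real.exp (-3 * Real.pi * r) ≤ g r w := by
  refine abs_le_of_sq_le_sq' ?_ (g_nonneg r w) |>.2
  rw [g_sq]
  nlinarith [mul_nonneg (mul_pos (Real.exp_pos (-3 * Real.pi * r))
    (Real.exp_pos (2 * Real.pi * r * w.im))).le (neg_nonneg.2 h), sq_nonneg
      (Real.exp (2 * Real.pi * r * w.im))]

/-- The half-angle form separates the radial gap, of order r, from the angular gap, of order r|t|
for moderate r|t|. -/
theorem g_ofReal_sq (r t : ℝ) :
    g r t ^ 2 = (1 - Real.exp (-3 * Real.pi * r)) ^ 2 +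
      4 * Real.exp (-3 * Real.pi * r) * Real.sin (Real.pi * r * t) ^ 2 := by
  have h := Real.cos_sq' (Real.pi * r * t)
  have h2 := Real.cos_two_mul (Real.pi * r * t)
  rw [g_sq]
  simp only [ofReal_re, ofReal_im, mul_zero, Real.exp_zero]
  rw [show 2 * Real.pi * r * t = 2 * (Real.pi * r * t) by ring, h2, h]
  ring

theorem g_ofReal_le {r : ℝ} (hr : 0 < r) (t : ℝ) :
    g r t ≤ 3 * Real.pi * r + 2 * Real.pi * r * |t| := by
  have hπ := Real.pi_pos
  have h1 : 1 - Real.exp (-3 * Real.pi * r) ≤ 3 * Real.pi * r := by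
    linarith [Real.add_one_le_exp (-3 * Real.pi * r)]
  have he : Real.exp (-3 * Real.pi * r) ≤ 1 := Real.exp_le_one_iff.2 (by nlinarith)
  have hs : Real.sin (Real.pi * r * t) ^ 2 ≤ (Real.pi * r * |t|) ^ 2 := by
    refine sq_le_sq.2 ?_
    rw [abs_of_nonneg (a := Real.pi * r * |t|) (by positivity)]
    calc _ ≤ |Real.pi * r * t| := Real.abs_sin_le_abs
      _ = _ := by rw [abs_mul, abs_of_pos (mul_pos hπ hr)]
  refine abs_le_of_sq_le_sq' ?_ (by positivity) |>.2
  rw [g_ofReal_sq]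
  have h3 : (1 - Real.exp (-3 * Real.pi * r)) ^ 2 ≤ (3 * Real.pi * r) ^ 2 :=
    pow_le_pow_left₀ (by linarith) h1 2
  have h4 : Real.exp (-3 * Real.pi * r) * Real.sin (Real.pi * r * t) ^ 2 ≤
      1 * (Real.pi * r * |t|) ^ 2 := mul_le_mul he hs (sq_nonneg _) zero_le_one
  have h5 : 0 ≤ Real.pi * r * (Real.pi * r * |t|) := by positivity
  nlinarith

/-- The radial gap alone suffices: 1 - e^{-3πr} ≥ r for r < 1/2. -/
theorem le_g_ofReal {r : ℝ} (hr : 0 < r) (hr' : r < 1 / 2) (t : ℝ) : r ≤ g r t := by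
  have hπ := Real.pi_pos
  have hπ' := Real.pi_le_four
  have hπ3 := Real.pi_gt_three
  have h := sub_le_g r t
  simp only [ofReal_im, mul_zero, Real.exp_zero] at h
  have h1 : Real.exp (-3 * Real.pi * r) * (1 + 3 * Real.pi * r) ≤ 1 := by
    calc _ ≤ Real.exp (-3 * Real.pi * r) * Real.exp (3 * Real.pi * r) := by
          gcongr; linarith [Real.add_one_le_exp (3 * Real.pi * r)]
      _ = 1 := by rw [← Real.exp_add]; simp
  have hx : 0 < Real.pi * r := by positivity
  refine le_trans ?_ h
  by_contra! hc
  have h2 : (1 - r) * (1 + 3 * Real.pi * r) < 1 := by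
    refine lt_of_lt_of_le ?_ h1
    gcongr; linarith
  nlinarith

theorem le_g_ofReal_of_mem {r t : ℝ} (hr : 0 < r) (hr' : r < 1 / 2) (h0 : 0 ≤ r * t)
    (h1 : r * t ≤ 3 / 4) : Real.exp (-(3 * Real.pi / 4)) * (r * t) ≤ g r t := by
  have hπ := Real.pi_pos
  -- Jordan's inequality on either side of π/2; the slope 2/3 is where 2(1 - u) meets the chord at u
  -- = 3/4.
  have hs : 2 / 3 * (r * t) ≤ Real.sin (Real.pi * r * t) := by
    rcases le_total (r * t) (1 / 2) with h | h
    · have := Real.mul_le_sin (x := Real.pi * r * t) (by nlinarith) (by nlinarith)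
      have e : 2 / Real.pi * (Real.pi * r * t) = 2 * (r * t) := by field_simp
      linarith
    · rw [← Real.sin_pi_sub]
      have := Real.mul_le_sin (x := Real.pi - Real.pi * r * t) (by nlinarith) (by nlinarith)
      have e : 2 / Real.pi * (Real.pi - Real.pi * r * t) = 2 * (1 - r * t) := by field_simp
      linarith
  have he : Real.exp (-(3 * Real.pi / 4)) ^ 2 ≤ Real.exp (-3 * Real.pi * r) := by
    rw [← Real.exp_nat_mul]
    refine Real.exp_le_exp.2 ?_
    push_cast
    nlinarith
  refine abs_le_of_sq_le_sq' ?_ (g_nonneg r t) |>.2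
  rw [g_ofReal_sq, mul_pow]
  have hs2 : (2 / 3 * (r * t)) ^ 2 ≤ Real.sin (Real.pi * r * t) ^ 2 :=
    pow_le_pow_left₀ (by positivity) hs 2
  have := mul_le_mul he hs2 (sq_nonneg _) (Real.exp_pos _).le
  have h3 := mul_nonneg (sq_nonneg (Real.exp (-(3 * Real.pi / 4)))) (sq_nonneg (r * t))
  nlinarith [sq_nonneg (1 - Real.exp (-3 * Real.pi * r))]

/-! ### Height estimates before normalisation -/

theorem G_re (r s : ℝ) (w : ℂ) : (G r s w).re = r * w.re := by
  simp [G]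

theorem G_im (r s : ℝ) (w : ℂ) : (G r s w).im = 1 / (4 * Real.pi) *
    (Real.log (g r (w + 1 / 2)) + Real.log (g r (w - s / r + 1 / 2))) := by
  unfold G
  rw [add_im, ofReal_im, im_ofReal_mul, I_im]
  ring

theorem preY₁_re (r s : ℝ) (w : ℂ) : (preY₁ r s w).re = r * w.re := by
  unfold preY₁
  split_ifs
  · exact G_re r s w
  · simp

theorem preY₁_im (r s : ℝ) (w : ℂ) :
    (preY₁ r s w).im = max (G r s w).im (G r s (-1 + w.im * I)).im := by
  unfold preY₁
  split_ifs with h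
  · rw [max_eq_left h]
  · rw [max_eq_right (not_le.1 h).le]; simp

theorem preY₂_re {r : ℝ} (hr : r ≠ 0) (s : ℝ) (w : ℂ) : (preY₂ r s w).re = r * w.re := by
  have hsr : ((s : ℂ) / r).re = s / r := by rw [← ofReal_div, ofReal_re]
  unfold preY₂
  split_ifs <;> simp only [preY₁_re, G_re, add_re, sub_re, ofReal_re, one_re, hsr] <;>
    field_simp <;> ring

/-- Every branch is `G` at a point of the same height, up to a real constant, so bounds depending on
height alone need no case analysis. -/
theorem exists_preY₂_im_eq (r s : ℝ) (w : ℂ) :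
    ∃ w' : ℂ, w'.im = w.im ∧ (preY₂ r s w).im = (G r s w').im := by
  have hsr : ((s : ℂ) / r).im = 0 := by rw [← ofReal_div, ofReal_im]
  have h₁ : ∃ w' : ℂ, w'.im = w.im ∧ (preY₁ r s w).im = (G r s w').im := by
    rw [preY₁_im]
    rcases max_choice (G r s w).im (G r s (-1 + w.im * I)).im with h | h
    · exact ⟨w, rfl, h⟩
    · exact ⟨_, by simp, h⟩
  unfold preY₂
  split_ifs
  all_goals first
    | exact h₁
    | exact ⟨w, rfl, rfl⟩
    | (simp only [add_im, sub_im, ofReal_im, add_zero, sub_zero]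
       exact ⟨_, by simp [hsr], rfl⟩)

theorem log_g_le {r : ℝ} (hr : 0 < r) (w : ℂ) :
    Real.log (g r w) ≤ Real.log 2 + 2 * Real.pi * r * max w.im 0 := by
  have hπ := Real.pi_pos
  have hm : 0 ≤ 2 * Real.pi * r * max w.im 0 := by positivity
  -- At a zero of `g` the logarithm takes the default value 0.
  rcases (g_nonneg r w).eq_or_lt with h | h
  · rw [← h, Real.log_zero]
    have := Real.log_pos one_lt_two
    linarith
  · rw [Real.log_le_iff_le_exp h, Real.exp_add, Real.exp_log two_pos]
    refine (g_le r w).trans ?_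
    have h1 : Real.exp (-3 * Real.pi * r) ≤ Real.exp (2 * Real.pi * r * max w.im 0) :=
      Real.exp_le_exp.2 (by nlinarith)
    have h2 : Real.exp (2 * Real.pi * r * w.im) ≤ Real.exp (2 * Real.pi * r * max w.im 0) :=
      Real.exp_le_exp.2 (by gcongr; exact le_max_left _ _)
    linarith

/-- At this height e^{2πr Im w} ≥ 2, so subtracting e^{-3πr} ≤ 1 costs at most a factor 2. -/
theorem le_log_g {r : ℝ} (hr : 0 < r) {w : ℂ} (hw : 1 / 2 ≤ r * w.im) :
    2 * Real.pi * r * w.im - Real.log 2 ≤ Real.log (g r w) := by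
  have hπ := Real.pi_gt_three
  have h1 : Real.exp (-3 * Real.pi * r) ≤ 1 := Real.exp_le_one_iff.2 (by nlinarith)
  have h2 : 2 ≤ Real.exp (2 * Real.pi * r * w.im) := by
    nlinarith [Real.add_one_le_exp (2 * Real.pi * r * w.im)]
  have h3 := sub_le_g r w
  rw [Real.le_log_iff_exp_le (by linarith), Real.exp_sub, Real.exp_log two_pos]
  linarith

theorem add_half_im (w : ℂ) : (w + 1 / 2).im = w.im := by simp

theorem sub_div_add_half_im (r s : ℝ) (w : ℂ) : (w - s / r + 1 / 2).im = w.im := by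
  rw [← ofReal_div]; simp

/-- Two logarithms of slope 2πr, divided by 4π, give slope exactly r. -/
theorem preY₂_im_le {r : ℝ} (hr : 0 < r) (s : ℝ) (w : ℂ) :
    (preY₂ r s w).im ≤ r * max w.im 0 + 1 := by
  obtain ⟨w', hw, h⟩ := exists_preY₂_im_eq r s w
  have hπ := Real.pi_gt_three
  have h1 := log_g_le hr (w' + 1 / 2)
  have h2 := log_g_le hr (w' - s / r + 1 / 2)
  rw [add_half_im, hw] at h1
  rw [sub_div_add_half_im, hw] at h2
  rw [h, G_im, one_div_mul_eq_div, div_le_iff₀ (by positivity)]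
  have := Real.log_two_lt_d9
  nlinarith

theorem le_preY₂_im {r : ℝ} (hr : 0 < r) (s : ℝ) {w : ℂ} (hw : 1 / 2 ≤ r * w.im) :
    r * w.im - 1 ≤ (preY₂ r s w).im := by
  obtain ⟨w', hw', h⟩ := exists_preY₂_im_eq r s w
  have hπ := Real.pi_gt_three
  have h1 := le_log_g hr (w := w' + 1 / 2) (by rwa [add_half_im, hw'])
  have h2 := le_log_g hr (w := w' - s / r + 1 / 2) (by rwa [sub_div_add_half_im, hw'])
  rw [add_half_im, hw'] at h1
  rw [sub_div_add_half_im, hw'] at h2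
  rw [h, G_im, one_div_mul_eq_div, le_div_iff₀ (by positivity)]
  have := Real.log_two_lt_d9
  nlinarith

/-! ### Active branches and the value at 0 -/

/-- Multiplication by r turns translates by (1/r)ℤ into integer translates, and an open interval
between consecutive integers contains none. -/
theorem not_mem_periodize {r x : ℝ} (hr : 0 < r) {S : Set ℝ} (n : ℤ)
    (h : ∀ y ∈ S, n < r * y - r * x ∧ r * y - r * x < n + 1) : x ∉ periodize r S := by
  rintro ⟨k, hk⟩
  obtain ⟨h1, h2⟩ := h _ hk
  have e : r * (x - k / r) - r * x = ((-k : ℤ) : ℝ) := by push_cast; field_simp; ring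
  rw [e] at h1 h2
  norm_cast at h1 h2
  lia

/-- The first alternative serves the good vertical line, the second the value at 0 when r ≤ s. -/
theorem preY₂_eq_preY₁ {r s : ℝ} (hr : 0 < r) (hr' : r < 1 / 2) (hs : 0 ≤ s) {w : ℂ}
    (h : s < r * w.re ∧ r * w.re < 1 - r ∨ r ≤ s ∧ s ≤ 1 / 2 ∧ w.re = 0) :
    preY₂ r s w = preY₁ r s w := by
  have hl : ∀ {a y : ℝ}, a / r - 1 < y → a - r < r * y := fun {a y} hy => by
    have := mul_lt_mul_of_pos_left hy hr
    rwa [mul_sub, mul_div_cancel₀ _ hr.ne', mul_one] at this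
  have hl' : ∀ {a y : ℝ}, a / r - 1 / 2 ≤ y → a - r / 2 ≤ r * y := fun {a y} hy => by
    have := mul_le_mul_of_nonneg_left hy hr.le
    rw [mul_sub, mul_div_cancel₀ _ hr.ne'] at this
    linarith
  have hu : ∀ {a y : ℝ}, y < a / r → r * y < a := fun {a y} hy => by
    rwa [lt_div_iff₀' hr] at hy
  have hm : ∀ n : ℤ, ∀ S : Set ℝ, (∀ y ∈ S, n < r * y - r * w.re ∧ r * y - r * w.re < n + 1) →
    w.re ∉ periodize r S := fun n S => not_mem_periodize hr n
  rcases h with ⟨h1, h2⟩ | ⟨h1, h2, h3⟩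
  · have hhi : ∀ {y : ℝ}, 1 - r < r * y → r * y ≤ 1 →
        ((0 : ℤ) : ℝ) < r * y - r * w.re ∧ r * y - r * w.re < ((0 : ℤ) : ℝ) + 1 :=
      fun {y} a b => by push_cast; constructor <;> linarith
    have hlo : ∀ {y : ℝ}, -r < r * y → r * y < s →
        ((-1 : ℤ) : ℝ) < r * y - r * w.re ∧ r * y - r * w.re < ((-1 : ℤ) : ℝ) + 1 :=
      fun {y} a b => by push_cast; constructor <;> linarith
    unfold preY₂
    split_ifs with c c1 c2 c3 c4 c1 c2 c3 c4 c5 c6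
    · refine absurd c1 (hm (-1) _ fun y hy => hlo ?_ ?_)
      · linarith [hl hy.1]
      · exact hu (by linarith [hy.2])
    · refine absurd c2 (hm (-1) _ fun y hy => hlo ?_ (hu hy.2))
      linarith [hl' hy.1]
    · refine absurd c3 (hm 0 _ fun y hy => hhi (hl hy.1) (hu ?_).le)
      linarith [hy.2]
    · refine absurd c4 (hm 0 _ fun y hy => hhi ?_ (hu hy.2).le)
      linarith [hl' hy.1]
    · rfl
    all_goals
      have e1 : r * (1 / r) = 1 := by field_simp
      have e2 : r * (s / r) = s := by field_simp
      have e3 : r * (s / (2 * r)) = s / 2 := by field_simp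
      have e4 : r * (1 / r - 1 + s / (2 * r)) = 1 - r + s / 2 := by field_simp
      have e5 : r * (1 / r + s / r - 1) = 1 + s - r := by field_simp
      have e6 : r * (1 / r + s / (2 * r) - 1 / 2) = 1 + s / 2 - r / 2 := by field_simp
    · refine absurd c1 (hm (-1) _ fun y hy => ?_)
      have a1 := mul_lt_mul_of_pos_left hy.1 hr
      have a2 := mul_le_mul_of_nonneg_left hy.2 hr.le
      rw [e3] at a2
      push_cast; constructor <;> linarith
    · refine absurd c2 (hm (-1) _ fun y hy => hlo ?_ (hu hy.2))
      have a1 := mul_le_mul_of_nonneg_left hy.1 hr.le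
      rw [e3] at a1
      linarith
    · refine absurd c3 (hm 0 _ fun y hy => hhi (hl hy.1) ?_)
      have a2 := mul_le_mul_of_nonneg_left hy.2 hr.le
      rw [e4] at a2
      linarith
    · refine absurd c4 (hm 0 _ fun y hy => hhi ?_ ?_)
      · have a1 := mul_lt_mul_of_pos_left hy.1 hr
        rw [e4] at a1
        linarith
      · have a2 := mul_le_mul_of_nonneg_left hy.2 hr.le
        rw [e5] at a2
        linarith
    · refine absurd c5 (hm 0 _ fun y hy => hhi ?_ ?_)
      · have a1 := mul_lt_mul_of_pos_left hy.1 hr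
        rw [e5] at a1
        linarith
      · have a2 := mul_le_mul_of_nonneg_left hy.2 hr.le
        rw [e6] at a2
        linarith
    · refine absurd c6 (hm 0 _ fun y hy => hhi ?_ ?_)
      · have a1 := mul_lt_mul_of_pos_left hy.1 hr
        rw [e6] at a1
        linarith
      · have a2 := mul_le_mul_of_nonneg_left hy.2 hr.le
        rw [e1] at a2
        linarith
    · rfl
  · have h0 : ∀ {y : ℝ}, 0 < r * y → r * y < 1 →
        ((0 : ℤ) : ℝ) < r * y - r * w.re ∧ r * y - r * w.re < ((0 : ℤ) : ℝ) + 1 :=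
      fun {y} a b => by rw [h3]; push_cast; constructor <;> linarith
    rw [preY₂, if_pos h1, if_neg, if_neg, if_neg, if_neg]
    · refine hm 0 _ fun y hy => h0 ?_ (hu hy.2)
      linarith [hl' hy.1]
    · refine hm 0 _ fun y hy => h0 ?_ (hu ?_)
      · linarith [hl hy.1]
      · linarith [hy.2]
    · refine hm 0 _ fun y hy => h0 ?_ ?_
      · linarith [hl' hy.1]
      · linarith [hu hy.2]
    · refine hm 0 _ fun y hy => h0 ?_ ?_
      · linarith [hl hy.1]
      · linarith [hu (a := s) (y := y) (by linarith [hy.2])]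

theorem preY₂_zero_of_lt {r s : ℝ} (hr : 0 < r) (hr' : r < 1 / 2) (hs : 0 ≤ s) (hsr : s < r) :
    preY₂ r s 0 = G r s (s / r) - s := by
  have e1 : r * (1 / r) = 1 := by field_simp
  have e2 : r * (s / r) = s := by field_simp
  have e3 : r * (s / (2 * r)) = s / 2 := by field_simp
  have e4 : r * (1 / r - 1 + s / (2 * r)) = 1 - r + s / 2 := by field_simp
  have e5 : r * (1 / r + s / r - 1) = 1 + s - r := by field_simp
  have e6 : r * (1 / r + s / (2 * r) - 1 / 2) = 1 + s / 2 - r / 2 := by field_simp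
  have e7 : r * (1 / r - 1) = 1 - r := by field_simp
  have h0 : ∀ S : Set ℝ, (∀ y ∈ S, 0 < r * y ∧ r * y < 1) →
      (0 : ℂ).re ∉ periodize r S := fun S hS => not_mem_periodize hr 0 fun y hy => by
    simpa using hS y hy
  have hlt : ∀ {a y : ℝ}, a < y → r * a < r * y := fun h => mul_lt_mul_of_pos_left h hr
  have hle : ∀ {a y : ℝ}, a ≤ y → r * a ≤ r * y := fun h => mul_le_mul_of_nonneg_left h hr.le
  rw [preY₂, if_neg (not_le.2 hsr), if_neg, if_neg, if_neg, if_neg, if_neg, if_pos, zero_add]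
  -- Modulo 1/r the origin is 1/r, the right endpoint of the last strip.
  · refine ⟨-1, ?_, ?_⟩
    · refine lt_of_mul_lt_mul_left (a := r) ?_ hr.le
      rw [e6]
      simp only [zero_re]
      push_cast
      have : r * (0 - -1 / r) = 1 := by field_simp; ring
      linarith
    · simp only [zero_re]
      push_cast
      rw [zero_sub, neg_div, neg_neg]
  · refine h0 _ fun y hy => ?_
    have a1 := hlt hy.1
    have a2 := hle hy.2
    rw [e5] at a1
    rw [e6] at a2
    constructor <;> linarith
  · refine h0 _ fun y hy => ?_
    have a1 := hlt hy.1
    have a2 := hle hy.2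
    rw [e4] at a1
    rw [e5] at a2
    constructor <;> linarith
  · refine h0 _ fun y hy => ?_
    have a1 := hlt hy.1
    have a2 := hle hy.2
    rw [e7] at a1
    rw [e4] at a2
    constructor <;> linarith
  · refine h0 _ fun y hy => ?_
    have a1 := hle hy.1
    have a2 := hlt hy.2
    rw [e3] at a1
    rw [e2] at a2
    constructor <;> linarith
  · refine h0 _ fun y hy => ?_
    have a1 := hlt hy.1
    have a2 := hle hy.2
    rw [e3] at a2
    constructor <;> linarith

/-- On the vertical line `Re w = (3/4 - r/2)/r`, which is far from both marked lines, `preY₂` is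
bounded below at every height. -/
theorem neg_three_le_preY₂_im {r s : ℝ} (hr : 0 < r) (hr' : r < 1 / 2) (hs : 0 ≤ s)
    (hs' : s ≤ 1 / 2) {w : ℂ} (hw : r * w.re = 3 / 4 - r / 2) : -3 ≤ (preY₂ r s w).im := by
  have hπ := Real.pi_gt_three
  rw [preY₂_eq_preY₁ hr hr' hs (Or.inl ⟨by linarith, by linarith⟩), preY₁_im]
  refine le_max_of_le_left ?_
  -- The two arguments of `g` have r Re z equal to 3/4 and 3/4 - s ≥ 1/4, a range where the cosine
  -- is nonpositive.
  have hg : ∀ z : ℂ, 1 / 4 ≤ r * z.re → r * z.re ≤ 3 / 4 →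
      -3 * Real.pi * r ≤ Real.log (g r z) := fun z h1 h2 => by
    have hc : Real.cos (2 * Real.pi * r * z.re) ≤ 0 :=
      Real.cos_nonpos_of_pi_div_two_le_of_le (by nlinarith) (by nlinarith)
    have := exp_le_g_of_cos_nonpos hc
    rwa [Real.le_log_iff_exp_le ((Real.exp_pos _).trans_le this)]
  have e1 : r * (w + 1 / 2).re = 3 / 4 := by
    simp only [add_re, one_div, inv_re, re_ofNat, mul_add, hw]; norm_num; ring
  have e2 : r * (w - s / r + 1 / 2).re = 3 / 4 - s := by
    have : (w - s / r + 1 / 2).re = (w + 1 / 2).re - s / r := by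
      rw [← ofReal_div]; simp; ring
    rw [this, mul_sub, e1]; field_simp
  have h1 := hg (w + 1 / 2) (by linarith) (by linarith)
  have h2 := hg (w - s / r + 1 / 2) (by linarith) (by linarith)
  rw [G_im, one_div_mul_eq_div, le_div_iff₀ (by positivity)]
  nlinarith

/-- `Im preY₂ r s 0` is `-𝓜(r, s) / 2π` up to a universal additive constant. -/
theorem exists_abs_preY₂_zero_im_add_bigM_le : ∃ C : ℝ, ∀ r s : ℝ, 0 < r → r < 1 / 2 → 0 ≤ s →
    s ≤ 1 / 2 → |(preY₂ r s 0).im + bigM r s / (2 * Real.pi)| ≤ C := by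
  have hπ := Real.pi_gt_three
  have hπ4 := Real.pi_le_four
  -- The factor 1/2 absorbs s + r/2 ≥ (r + s)/2 when r ≤ s, and r ≥ (r + s)/2 when s < r.
  set c : ℝ := Real.exp (-(3 * Real.pi / 4)) / 2 with hc
  have hc0 : 0 < c := by positivity
  have hc1 : c ≤ 1 / 2 := by
    have : Real.exp (-(3 * Real.pi / 4)) ≤ 1 := Real.exp_le_one_iff.2 (by linarith)
    linarith
  refine ⟨(Real.log 20 - Real.log c) / (2 * Real.pi), fun r s hr hr' hs hs' => ?_⟩
  have hM : bigM r s / (2 * Real.pi) =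
      -(1 / (4 * Real.pi) * (Real.log r + Real.log (r + s))) := by
    unfold bigM
    rw [one_div r, one_div (s + r), Real.log_inv, Real.log_inv, add_comm s r]
    field_simp
    ring
  have hlo : ∀ {x y : ℝ}, 0 < x → c * x ≤ y → Real.log c + Real.log x ≤ Real.log y :=
    fun {x y} hx h => by
      rw [← Real.log_mul hc0.ne' hx.ne']
      exact Real.log_le_log (by positivity) h
  have hhi : ∀ {x y : ℝ}, 0 < x → 0 < y → y ≤ 20 * x → Real.log y ≤ Real.log 20 + Real.log x :=
    fun {x y} hx hy h => by
      rw [← Real.log_mul (by norm_num) hx.ne']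
      exact Real.log_le_log hy h
  have hpos : ∀ t : ℝ, 0 < g r t := fun t => hr.trans_le (le_g_ofReal hr hr' t)
  -- Since π ≤ 4, the bound 3πr + 2πr|t| is at most 12r + 8r|t|.
  have hup : ∀ t : ℝ, ∀ x : ℝ, 0 < x → 12 * r + 8 * (r * |t|) ≤ 20 * x →
      Real.log (g r t) ≤ Real.log 20 + Real.log x := fun t x hx h => by
    refine hhi hx (hpos t) ((g_ofReal_le hr t).trans (le_trans ?_ h))
    have : 0 ≤ r * |t| := by positivity
    nlinarith
  have hdn : ∀ t : ℝ, Real.log c + Real.log r ≤ Real.log (g r t) := fun t =>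
    hlo hr ((by nlinarith : c * r ≤ r).trans (le_g_ofReal hr hr' t))
  have hrs : 0 < r + s := by linarith
  have key : 1 / (4 * Real.pi) * (Real.log c + Real.log r + (Real.log c + Real.log (r + s))) ≤
      (preY₂ r s 0).im ∧ (preY₂ r s 0).im ≤
      1 / (4 * Real.pi) * (Real.log 20 + Real.log r + (Real.log 20 + Real.log (r + s))) := by
    have h4 : 0 ≤ 1 / (4 * Real.pi) := by positivity
    have half1 : |(1 / 2 : ℝ)| = 1 / 2 := abs_of_pos (by norm_num)
    have half2 : |(-1 / 2 : ℝ)| = 1 / 2 := by rw [abs_of_neg] <;> norm_num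
    rcases le_or_gt r s with h | h
    · rw [preY₂_eq_preY₁ hr hr' hs (Or.inr ⟨h, hs', rfl⟩), preY₁_im, G_im, G_im]
      rw [show (0 : ℂ) + 1 / 2 = ((1 / 2 : ℝ) : ℂ) by push_cast; ring,
        show (0 : ℂ) - s / r + 1 / 2 = ((-(s / r) + 1 / 2 : ℝ) : ℂ) by push_cast; ring,
        show (-1 + ((0 : ℂ).im : ℂ) * I) + 1 / 2 = ((-1 / 2 : ℝ) : ℂ) by push_cast; simp; ring,
        show (-1 + ((0 : ℂ).im : ℂ) * I) - s / r + 1 / 2 = ((-(s / r + 1 / 2) : ℝ) : ℂ) by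
          push_cast; simp; ring]
      have e : r * (s / r + 1 / 2) = s + r / 2 := by field_simp
      have hsr : 0 ≤ s / r := by positivity
      have ht1 : r * |-(s / r) + 1 / 2| ≤ s + r / 2 := by
        rw [← e]
        gcongr
        refine (abs_add_le _ _).trans ?_
        rw [abs_neg, abs_of_nonneg hsr, half1]
      have ht2 : r * |-(s / r + 1 / 2)| = s + r / 2 := by
        rw [abs_neg, abs_of_nonneg (by positivity), e]
      constructor
      -- The lower bound comes from the cutoff `G(-1)`, where the second factor has r|t| = s + r/2.
      · refine le_max_of_le_right (mul_le_mul_of_nonneg_left (add_le_add (hdn _) (hlo hrs ?_)) h4)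
        have hsym : g r ((-(s / r + 1 / 2) : ℝ) : ℂ) = g r ((s / r + 1 / 2 : ℝ) : ℂ) := by
          rw [← sq_eq_sq₀ (g_nonneg _ _) (g_nonneg _ _), g_ofReal_sq, g_ofReal_sq, mul_neg,
            Real.sin_neg, neg_sq]
        rw [hsym]
        have := le_g_ofReal_of_mem (t := s / r + 1 / 2) hr hr' (by rw [e]; linarith)
          (by rw [e]; linarith)
        rw [e] at this
        refine le_trans ?_ this
        rw [hc]
        have := Real.exp_pos (-(3 * Real.pi / 4))
        nlinarith
      · refine max_le (mul_le_mul_of_nonneg_left (add_le_add (hup _ _ hr ?_) (hup _ _ hrs ?_)) h4)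
          (mul_le_mul_of_nonneg_left (add_le_add (hup _ _ hr ?_) (hup _ _ hrs ?_)) h4)
        · rw [half1]; linarith
        · linarith
        · rw [half2]; linarith
        · rw [ht2]; linarith
    · rw [preY₂_zero_of_lt hr hr' hs h, sub_im, ofReal_im, sub_zero, G_im,
        show (s : ℂ) / r + 1 / 2 = ((s / r + 1 / 2 : ℝ) : ℂ) by push_cast; ring,
        show (s : ℂ) / r - s / r + 1 / 2 = ((1 / 2 : ℝ) : ℂ) by push_cast; ring]
      have e : r * |s / r + 1 / 2| = s + r / 2 := by
        rw [abs_of_nonneg (by positivity)]; field_simp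
      constructor
      · refine mul_le_mul_of_nonneg_left (add_le_add (hdn _) (hlo hrs ?_)) h4
        refine le_trans ?_ (le_g_ofReal hr hr' _)
        nlinarith
      -- In this branch the first factor is the one compared with r + s.
      · rw [add_comm (Real.log (g _ _))]
        refine mul_le_mul_of_nonneg_left (add_le_add (hup _ _ hr ?_) (hup _ _ hrs ?_)) h4
        · rw [half1]; linarith
        · rw [e]; linarith
  have hl20 : 0 ≤ Real.log 20 := Real.log_nonneg (by norm_num)
  have hlc : Real.log c ≤ 0 := Real.log_nonpos hc0.le (by linarith)
  have hp2 : 0 < 1 / (4 * Real.pi) := by positivity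
  have e : (Real.log 20 - Real.log c) / (2 * Real.pi) =
      1 / (4 * Real.pi) * (2 * (Real.log 20 - Real.log c)) := by field_simp; ring
  rw [hM, e, abs_le]
  constructor
  · have := mul_nonneg hp2.le hl20
    linarith [key.1]
  · have := mul_nonneg hp2.le (neg_nonneg.2 hlc)
    linarith [key.2]

/-! ### Estimates for the normalised maps -/

theorem Yside_re {r : ℝ} (hr : r ≠ 0) (s : ℝ) (b : Bool) (w : ℂ) :
    (Yside r s b w).re = r * w.re := by
  cases b
  · simp only [Yside, Y, Bool.false_eq_true, if_false, sub_re, preY₂_re hr, add_re, zero_re,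
      ← ofReal_div, ofReal_re]
    field_simp
    ring
  · simp [Yside, Y, preY₂_re hr]

theorem Yside_im (r s : ℝ) (b : Bool) (w : ℂ) : (Yside r s b w).im =
    (preY₂ r s (w + ((if b then 0 else s / r : ℝ) : ℂ))).im - (preY₂ r s 0).im := by
  cases b <;> simp [Yside, Y]

/-- The three estimates on `Im Yside`: from above, from below at large height, and from below on
some vertical line. -/
theorem exists_Yside_im_estimates : ∃ C : ℝ, 0 ≤ C ∧ ∀ r s : ℝ, 0 < r → r < 1 / 2 → 0 ≤ s →
    s ≤ 1 / 2 → ∀ b : Bool,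
    (∀ w, (Yside r s b w).im ≤ r * max w.im 0 + bigM r s / (2 * Real.pi) + C) ∧
    (∀ w : ℂ, 1 / 2 ≤ r * w.im →
      r * w.im + bigM r s / (2 * Real.pi) - C ≤ (Yside r s b w).im) ∧
    ∃ x : ℝ, 0 < x ∧ x < 1 / r ∧ ∀ w : ℂ, w.re = x →
      bigM r s / (2 * Real.pi) - C ≤ (Yside r s b w).im := by
  obtain ⟨C, hC⟩ := exists_abs_preY₂_zero_im_add_bigM_le
  have hC0 : 0 ≤ C :=
    (abs_nonneg _).trans (hC (1 / 4) 0 (by norm_num) (by norm_num) le_rfl (by norm_num))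
  refine ⟨C + 3, by linarith, fun r s hr hr' hs hs' b => ?_⟩
  obtain ⟨h1, h2⟩ := abs_le.1 (hC r s hr hr' hs hs')
  set t : ℝ := if b then 0 else s / r with ht
  have htr : 0 ≤ r * t ∧ r * t ≤ 1 / 2 := by
    rw [ht]
    split_ifs
    · simp
    · rw [mul_div_cancel₀ _ hr.ne']; exact ⟨hs, hs'⟩
  have him : ∀ w : ℂ, (w + (t : ℂ)).im = w.im := fun w => by simp
  -- The good line moved back by t; positivity uses r/2 < 1/4 and rt ≤ 1/2.
  refine ⟨fun w => ?_, fun w hw => ?_, (3 / 4 - r / 2) / r - t, ?_, ?_, fun w hw => ?_⟩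
  · have := preY₂_im_le hr s (w + t)
    rw [him] at this
    rw [Yside_im]
    linarith
  · have := le_preY₂_im hr s (w := w + t) (by rwa [him])
    rw [him] at this
    rw [Yside_im]
    linarith
  · rw [sub_pos, lt_div_iff₀ hr]
    linarith
  · refine sub_lt_iff_lt_add.2 ?_
    rw [div_lt_iff₀ hr, add_mul, one_div_mul_cancel hr.ne']
    linarith
  · have := neg_three_le_preY₂_im hr hr' hs hs' (w := w + t) (by
      rw [add_re, hw, ofReal_re, sub_add_cancel, mul_div_cancel₀ _ hr.ne'])
    rw [Yside_im]
    linarith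

/-! ### Arithmetic of the sequences -/

open Set

theorem distInt_nonneg (x : ℝ) : 0 ≤ distInt x := abs_nonneg _

theorem distInt_le_half (x : ℝ) : distInt x ≤ 1 / 2 := abs_sub_round x

theorem distInt_of_mem_Icc {x : ℝ} (h0 : 0 ≤ x) (h1 : x ≤ 1 / 2) : distInt x = x := by
  rcases h1.eq_or_lt with rfl | h
  · have : round (1 / 2 : ℝ) = 1 := by rw [one_div]; exact round_two_inv
    rw [distInt, this]; norm_num
  · have : round x = 0 := round_eq_zero_iff.2 ⟨by linarith, h⟩
    rw [distInt, this, Int.cast_zero, sub_zero, abs_of_nonneg h0]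

theorem Irrational.distInt {x : ℝ} (h : Irrational x) : Irrational (distInt x) := by
  unfold BiCritical.distInt
  rcases abs_choice (x - round x) with e | e <;> rw [e]
  · exact h.sub_intCast _
  · exact (h.sub_intCast _).neg

theorem alphaSeq_irrational {α : ℝ} (h : Irrational α) (n : ℕ) : Irrational (alphaSeq α n) := by
  induction n with
  | zero => exact Irrational.distInt h
  | succ n ih => rw [alphaSeq, one_div]; exact Irrational.distInt ih.inv

theorem alphaSeq_pos {α : ℝ} (h : Irrational α) (n : ℕ) : 0 < alphaSeq α n := by
  refine lt_of_le_of_ne ?_ (alphaSeq_irrational h n).ne_zero.symm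
  cases n <;> exact distInt_nonneg _

theorem alphaSeq_lt_half {α : ℝ} (h : Irrational α) (n : ℕ) : alphaSeq α n < 1 / 2 := by
  refine lt_of_le_of_ne ?_ fun e => (alphaSeq_irrational h n) ⟨1 / 2, by rw [e]; push_cast; rfl⟩
  cases n <;> exact distInt_le_half _

theorem betaSeq_nonneg (α β : ℝ) (n : ℕ) : 0 ≤ betaSeq α β n := by
  cases n <;> exact distInt_nonneg _

theorem betaSeq_le_half (α β : ℝ) (n : ℕ) : betaSeq α β n ≤ 1 / 2 := by
  cases n <;> exact distInt_le_half _

theorem signInt_eq (x : ℝ) : signInt x = -1 ∨ signInt x = 1 := by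
  unfold signInt; split_ifs <;> simp

theorem epsSeq_eq (α : ℝ) (n : ℕ) : epsSeq α n = -1 ∨ epsSeq α n = 1 := by
  cases n <;> exact signInt_eq _

theorem aSeq_add_epsSeq_mul_alphaSeq (α : ℝ) (n : ℕ) :
    (aSeq α n : ℝ) + epsSeq α (n + 1) * alphaSeq α (n + 1) = 1 / alphaSeq α n :=
  round_add_signInt_mul_distInt _

/-- As αₘ lies in (0, 1/2), `distInt` fixes it, so restarting the algorithm at αₘ continues the same
orbit. -/
theorem alphaSeq_alphaSeq {α : ℝ} (h : Irrational α) (m k : ℕ) :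
    alphaSeq (alphaSeq α m) k = alphaSeq α (m + k) := by
  induction k with
  | zero => exact distInt_of_mem_Icc (alphaSeq_pos h m).le (alphaSeq_lt_half h m).le
  | succ k ih => rw [alphaSeq, ih]; rfl

theorem betaSeq_alphaSeq_betaSeq {α : ℝ} (h : Irrational α) (β : ℝ) (m k : ℕ) :
    betaSeq (alphaSeq α m) (betaSeq α β m) k = betaSeq α β (m + k) := by
  induction k with
  | zero => exact distInt_of_mem_Icc (betaSeq_nonneg α β m) (betaSeq_le_half α β m)
  | succ k ih => rw [betaSeq, ih, alphaSeq_alphaSeq h]; rfl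

theorem two_le_aSeq {α : ℝ} (h : Irrational α) (n : ℕ) : 2 ≤ aSeq α n := by
  have h1 := aSeq_add_epsSeq_mul_alphaSeq α n
  have h2 : 2 < 1 / alphaSeq α n := by
    rw [lt_div_iff₀ (alphaSeq_pos h n)]
    linarith [alphaSeq_lt_half h n]
  have h3 := alphaSeq_pos h (n + 1)
  have h4 := alphaSeq_lt_half h (n + 1)
  have : (1 : ℝ) < aSeq α n := by
    rcases epsSeq_eq α (n + 1) with e | e <;> rw [e] at h1 <;> push_cast at h1 <;> linarith
  have : 1 < aSeq α n := by exact_mod_cast this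
  lia

theorem one_le_width {α : ℝ} (h : Irrational α) (m : ℕ) : 1 ≤ width α m := by
  cases m with
  | zero => exact le_rfl
  | succ n =>
    rw [width, le_div_iff₀ (alphaSeq_pos h n)]
    linarith [alphaSeq_lt_half h n]

/-! ### The tiling of the level sets -/

theorem Yn_im (α β : ℝ) (n : ℕ) (w : ℂ) : (Yn α β n w).im =
    (Yside (alphaSeq α n) (betaSeq α β n) (decide (epsSeq α n = deltaSeq α β n)) w).im := by
  unfold Yn
  split_ifs <;> simp

theorem Yn_re {α : ℝ} (h : Irrational α) (β : ℝ) (n : ℕ) (w : ℂ) :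
    (Yn α β n w).re = -epsSeq α n * (alphaSeq α n * w.re) := by
  unfold Yn
  rcases epsSeq_eq α n with e | e
  · rw [if_pos e, Yside_re (alphaSeq_pos h n).ne', e]; simp
  · rw [if_neg (by rw [e]; decide), neg_re, conj_re, Yside_re (alphaSeq_pos h n).ne', e]; simp

/-- Full tiles have width 1. The partial tile has width 1 - αₙ₊₁ if εₙ₊₁ = -1 and αₙ₊₁ if εₙ₊₁ = 1,
which brings the total to 1/αₙ. -/
theorem levelSet_re_mem {α : ℝ} (h : Irrational α) (β : ℝ) (j m : ℕ) :
    ∀ w ∈ levelSet α β j m, w.re ∈ Icc 0 (width α m) := by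
  induction j generalizing m with
  | zero => exact fun w hw => hw.1
  | succ j ih =>
    have hr := alphaSeq_pos h
    have hb : ∀ n, ∀ w ∈ levelSet α β j (n + 1), 0 ≤ alphaSeq α n * w.re ∧
        alphaSeq α n * w.re ≤ 1 := fun n w hw => by
      obtain ⟨h1, h2⟩ := ih (n + 1) w hw
      rw [width, le_div_iff₀ (hr n)] at h2
      exact ⟨mul_nonneg (hr n).le h1, by linarith⟩
    cases m with
    | zero =>
      rintro _ ⟨w, hw, rfl⟩
      obtain ⟨h1, h2⟩ := hb 0 w hw
      rcases epsSeq_eq α 0 with e | e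
      · simp [width, Yn_re h, e, h1, h2]
      · simp [width, Yn_re h, e, h1, h2]
    | succ n =>
      intro z hz
      have ha : (2 : ℝ) ≤ aSeq α n := by exact_mod_cast two_le_aSeq h n
      have hw1 := aSeq_add_epsSeq_mul_alphaSeq α n
      have hn1 := hr (n + 1)
      have hn2 := alphaSeq_lt_half h (n + 1)
      have hmul : alphaSeq α (n + 1) * (1 / alphaSeq α (n + 1) - 1) =
        1 - alphaSeq α (n + 1) := by field_simp
      rw [width, ← hw1]
      unfold levelSet at hz
      split_ifs at hz with e
      · rw [e]
        rcases hz with hz | ⟨w, ⟨hw, h3⟩, rfl⟩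
        · simp only [mem_iUnion] at hz
          obtain ⟨l, hl, w, hw, rfl⟩ := hz
          obtain ⟨h1, h2⟩ := hb _ w hw
          have hl1 : (0 : ℝ) ≤ l := by exact_mod_cast hl.1
          have hl2 : (l : ℝ) ≤ aSeq α n - 2 := by exact_mod_cast hl.2
          simp only [add_re, Yn_re h, e, intCast_re]
          push_cast
          constructor <;> linarith
        · obtain ⟨h1, h2⟩ := hb _ w hw
          have h4 := mul_le_mul_of_nonneg_left h3.2 hn1.le
          rw [hmul] at h4
          simp only [add_re, sub_re, one_re, Yn_re h, e, intCast_re]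
          push_cast
          constructor <;> linarith
      · have e' := (epsSeq_eq α (n + 1)).resolve_left e
        rw [e']
        rcases hz with hz | ⟨w, ⟨hw, h3⟩, rfl⟩
        · simp only [mem_iUnion] at hz
          obtain ⟨l, hl, w, hw, rfl⟩ := hz
          obtain ⟨h1, h2⟩ := hb _ w hw
          have hl1 : (1 : ℝ) ≤ l := by exact_mod_cast hl.1
          have hl2 : (l : ℝ) ≤ aSeq α n := by exact_mod_cast hl.2
          simp only [add_re, Yn_re h, e', intCast_re]
          push_cast
          constructor <;> linarith
        · obtain ⟨h1, h2⟩ := hb _ w hw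
          have h4 := mul_le_mul_of_nonneg_left h3.1 hn1.le
          rw [hmul] at h4
          simp only [add_re, one_re, Yn_re h, e', intCast_re]
          push_cast
          constructor <;> linarith

/-- Every point of a level set is an integer translate of the image of a point of the next one. -/
theorem exists_eq_Yn_add {α : ℝ} (β : ℝ) (j m : ℕ) {z : ℂ} (hz : z ∈ levelSet α β (j + 1) m) :
    ∃ l : ℤ, ∃ w ∈ levelSet α β j (m + 1), z = Yn α β m w + l := by
  cases m with
  | zero =>
    obtain ⟨w, hw, rfl⟩ := hz
    rcases epsSeq_eq α 0 with e | e
    · exact ⟨0, w, hw, by simp [e]⟩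
    · exact ⟨1, w, hw, by simp [e]⟩
  | succ n =>
    unfold levelSet at hz
    split_ifs at hz with e
    · rcases hz with hz | ⟨w, ⟨hw, -⟩, rfl⟩
      · simp only [mem_iUnion] at hz
        obtain ⟨l, -, w, hw, rfl⟩ := hz
        exact ⟨l, w, hw, rfl⟩
      · exact ⟨aSeq α n - 1, w, hw, by push_cast; rfl⟩
    · rcases hz with hz | ⟨w, ⟨hw, -⟩, rfl⟩
      · simp only [mem_iUnion] at hz
        obtain ⟨l, -, w, hw, rfl⟩ := hz
        exact ⟨l, w, hw, rfl⟩
      · exact ⟨aSeq α n + 1, w, hw, by push_cast; rfl⟩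

/-- For each point `x` of the base there is a point `x'` of the base of the next level such that
the points of the next level set above `x'` are mapped into the level set above `x`. -/
theorem exists_forall_Yn_mem {α : ℝ} (h : Irrational α) (β : ℝ) (j m : ℕ) {x : ℝ}
    (hx : x ∈ Icc 0 (width α m)) : ∃ x' ∈ Icc 0 (width α (m + 1)),
      ∀ w ∈ levelSet α β j (m + 1), w.re = x' →
        (x : ℂ) + (Yn α β m w).im * I ∈ levelSet α β (j + 1) m := by
  have hr := alphaSeq_pos h m
  set r := alphaSeq α m with hrdef
  have hIcc : ∀ {u : ℝ}, 0 ≤ u → u ≤ 1 → u / r ∈ Icc 0 (width α (m + 1)) := fun h0 h1 =>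
    ⟨by positivity, by rw [width]; gcongr⟩
  have heq : ∀ {w : ℂ} {u l : ℝ}, w.re = u / r → -epsSeq α m * u + l = x →
      Yn α β m w + l = (x : ℂ) + (Yn α β m w).im * I := fun {w u l} hw hl => by
    apply Complex.ext
    · simp only [add_re, Yn_re h, ofReal_re, hw, mul_re, I_re, I_im, ofReal_im, ← hrdef]
      rw [mul_div_cancel₀ _ hr.ne']
      linarith
    · simp
  cases m with
  | zero =>
    obtain ⟨h0, h1⟩ := hx
    change x ≤ 1 at h1
    rcases epsSeq_eq α 0 with e | e
    · refine ⟨x / r, hIcc h0 h1, fun w hw hwx => ⟨w, hw, ?_⟩⟩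
      rw [← heq (l := 0) hwx (by rw [e]; simp)]
      simp [e]
    · refine ⟨(1 - x) / r, hIcc (by linarith) (by linarith), fun w hw hwx => ⟨w, hw, ?_⟩⟩
      rw [← heq (l := 1) hwx (by rw [e]; simp)]
      simp [e]
  | succ n =>
    obtain ⟨h0, h1⟩ := hx
    have ha := two_le_aSeq h n
    have hw1 := aSeq_add_epsSeq_mul_alphaSeq α n
    rw [width, ← hw1, ← hrdef] at h1
    have hmul : (1 - r) / r = 1 / r - 1 := by field_simp
    have hf1 := Int.floor_le x
    have hf2 := Int.lt_floor_add_one x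
    have hf0 : 0 ≤ ⌊x⌋ := Int.floor_nonneg.2 h0
    rcases epsSeq_eq α (n + 1) with e | e
    · rw [e] at h1
      rcases le_or_gt ⌊x⌋ (aSeq α n - 2) with hl | hl
      · refine ⟨(x - ⌊x⌋) / r, hIcc (by linarith) (by linarith), fun w hw hwx => ?_⟩
        rw [levelSet, if_pos e]
        refine Or.inl (mem_iUnion₂.2 ⟨⌊x⌋, ⟨hf0, hl⟩, w, hw, ?_⟩)
        rw [← heq (l := ⌊x⌋) hwx (by rw [e]; push_cast; ring)]
        push_cast; rfl
      -- Here x lies in the last, partial tile, and its offset is at most 1 - r.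
      · have hx1 : (aSeq α n : ℝ) - 1 ≤ ⌊x⌋ := by
          exact_mod_cast (by lia : aSeq α n - 1 ≤ ⌊x⌋)
        push_cast at h1
        have hx2 : x - (aSeq α n - 1) ≤ 1 - r := by linarith
        refine ⟨(x - (aSeq α n - 1)) / r, hIcc (by linarith) (by linarith), fun w hw hwx => ?_⟩
        rw [levelSet, if_pos e]
        refine Or.inr ⟨w, ⟨hw, ?_⟩, ?_⟩
        · rw [hwx, ← hrdef, ← hmul]
          exact ⟨div_nonneg (by linarith) hr.le, by gcongr⟩
        · rw [← heq (l := aSeq α n - 1) hwx (by rw [e]; push_cast; ring)]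
          push_cast; rfl
    · have ne : epsSeq α (n + 1) ≠ -1 := by rw [e]; decide
      rw [e] at h1
      rcases lt_or_ge ⌊x⌋ (aSeq α n) with hl | hl
      · refine ⟨(⌊x⌋ + 1 - x) / r, hIcc (by linarith) (by linarith), fun w hw hwx => ?_⟩
        rw [levelSet, if_neg ne]
        -- The reflection makes tile l cover [l - 1, l], hence the index ⌊x⌋ + 1.
        refine Or.inl (mem_iUnion₂.2 ⟨⌊x⌋ + 1, ⟨by lia, by lia⟩, w, hw, ?_⟩)
        rw [← heq (l := ⌊x⌋ + 1) hwx (by rw [e]; push_cast; ring)]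
        push_cast; rfl
      · have hx1 : (aSeq α n : ℝ) ≤ ⌊x⌋ := by exact_mod_cast hl
        push_cast at h1
        have hx2 : 1 - r ≤ aSeq α n + 1 - x := by linarith
        refine ⟨(aSeq α n + 1 - x) / r,
          hIcc (by linarith [alphaSeq_lt_half h (n + 1)]) (by linarith), fun w hw hwx => ?_⟩
        rw [levelSet, if_neg ne]
        refine Or.inr ⟨w, ⟨hw, ?_⟩, ?_⟩
        · rw [hwx, ← hrdef, ← hmul]
          exact ⟨by gcongr, by gcongr; linarith⟩
        · rw [← heq (l := aSeq α n + 1) hwx (by rw [e]; push_cast; ring)]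
          push_cast; rfl

/-- For each interior point `x'` of the base at the next level there is an interior point `x` of
the base such that the level set above `x` comes only from points above `x'`. -/
theorem exists_forall_mem_eq_Yn_im {α : ℝ} (h : Irrational α) (β : ℝ) (j m : ℕ) {x' : ℝ}
    (hx' : x' ∈ Ioo 0 (width α (m + 1))) : ∃ x ∈ Ioo 0 (width α m), ∀ y : ℝ,
      (x : ℂ) + y * I ∈ levelSet α β (j + 1) m →
        ∃ w ∈ levelSet α β j (m + 1), w.re = x' ∧ (Yn α β m w).im = y := by
  have hr := alphaSeq_pos h m
  have h1w := one_le_width h m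
  set r := alphaSeq α m with hrdef
  obtain ⟨h0, h1⟩ := hx'
  rw [width, ← hrdef, lt_div_iff₀ hr] at h1
  have hp : 0 < r * x' := by positivity
  have main : ∀ l₀ : ℤ, -epsSeq α m * (r * x') + l₀ ∈ Ioo (0 : ℝ) 1 → ∀ y : ℝ,
      ((-epsSeq α m * (r * x') + l₀ : ℝ) : ℂ) + y * I ∈ levelSet α β (j + 1) m →
        ∃ w ∈ levelSet α β j (m + 1), w.re = x' ∧ (Yn α β m w).im = y := by
    intro l₀ hl₀ y hy
    obtain ⟨l, w, hw, e⟩ := exists_eq_Yn_add β j m hy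
    obtain ⟨h3, h4⟩ := levelSet_re_mem h β j (m + 1) w hw
    rw [width, ← hrdef, le_div_iff₀ hr] at h4
    have hre := congrArg Complex.re e
    have him := congrArg Complex.im e
    simp only [add_re, ofReal_re, mul_re, I_re, I_im, ofReal_im, Yn_re h, intCast_re, ← hrdef]
      at hre
    simp at him
    have h5 : 0 ≤ r * w.re := by positivity
    -- An interior point belongs to no second tile: strictness gives |l - l₀| < 1.
    have hl : l = l₀ := by
      have a1 : ((l - l₀ : ℤ) : ℝ) < 1 ∧ (-1 : ℝ) < ((l - l₀ : ℤ) : ℝ) := by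
        push_cast
        rcases epsSeq_eq α m with e | e <;> rw [e] at hre <;> push_cast at hre <;>
          constructor <;> linarith
      have a2 : l - l₀ < 1 := by exact_mod_cast a1.1
      have a3 : -1 < l - l₀ := by exact_mod_cast a1.2
      lia
    refine ⟨w, hw, ?_, him.symm⟩
    have : r * w.re = r * x' := by
      rw [hl] at hre
      rcases epsSeq_eq α m with e | e <;> rw [e] at hre <;> push_cast at hre <;> linarith
    exact mul_left_cancel₀ hr.ne' this
  have fin : ∀ l₀ : ℤ, -epsSeq α m * (r * x') + l₀ ∈ Ioo (0 : ℝ) 1 → _ := fun l₀ hl₀ =>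
    (⟨_, ⟨hl₀.1, hl₀.2.trans_le h1w⟩, main l₀ hl₀⟩ : ∃ x ∈ Ioo 0 (width α m), ∀ y : ℝ,
      (x : ℂ) + y * I ∈ levelSet α β (j + 1) m →
        ∃ w ∈ levelSet α β j (m + 1), w.re = x' ∧ (Yn α β m w).im = y)
  rcases epsSeq_eq α m with e | e
  · exact fin 0 (by rw [e]; push_cast; constructor <;> linarith)
  · exact fin 1 (by rw [e]; push_cast; constructor <;> linarith)

/-! ### Partial sums of the modified Brjuno sum -/

/-- The terms `(α_m ⋯ α_{m+k-1}) 𝓜(α_{m+k}, β_{m+k})` of the modified Brjuno sum at level `m`. -/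
noncomputable def brjunoTerm (α β : ℝ) (m k : ℕ) : ℝ :=
  (∏ i ∈ Finset.range k, alphaSeq α (m + i)) * bigM (alphaSeq α (m + k)) (betaSeq α β (m + k))

theorem brjunoTerm_zero (α β : ℝ) (m : ℕ) :
    brjunoTerm α β m 0 = bigM (alphaSeq α m) (betaSeq α β m) := by
  simp [brjunoTerm]

theorem brjunoTerm_succ (α β : ℝ) (m k : ℕ) :
    brjunoTerm α β m (k + 1) = alphaSeq α m * brjunoTerm α β (m + 1) k := by
  simp only [brjunoTerm, Finset.prod_range_succ', add_zero, mul_comm _ (alphaSeq α m), mul_assoc,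
    add_right_comm m 1, ← add_assoc]

theorem sum_brjunoTerm_succ (α β : ℝ) (m j : ℕ) :
    ∑ k ∈ Finset.range (j + 1), brjunoTerm α β m k =
      alphaSeq α m * ∑ k ∈ Finset.range j, brjunoTerm α β (m + 1) k +
        bigM (alphaSeq α m) (betaSeq α β m) := by
  rw [Finset.sum_range_succ', brjunoTerm_zero, Finset.mul_sum]
  simp only [brjunoTerm_succ]

theorem half_log_le_bigM {r s : ℝ} (hr : 0 < r) (hr' : r ≤ 1 / 2) (hs : 0 ≤ s)
    (hs' : s ≤ 1 / 2) : 1 / 2 * Real.log (1 / r) ≤ bigM r s := by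
  have : 0 ≤ Real.log (1 / (s + r)) := Real.log_nonneg (by
    rw [le_div_iff₀ (by linarith)]; linarith)
  unfold bigM
  linarith

theorem bigM_le_log {r s : ℝ} (hr : 0 < r) (hs : 0 ≤ s) : bigM r s ≤ Real.log (1 / r) := by
  have : Real.log (1 / (s + r)) ≤ Real.log (1 / r) :=
    Real.log_le_log (by positivity) (one_div_le_one_div_of_le hr (by linarith))
  unfold bigM
  linarith

theorem log_one_div_alphaSeq_nonneg {α : ℝ} (h : Irrational α) (n : ℕ) :
    0 ≤ Real.log (1 / alphaSeq α n) := Real.log_nonneg (by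
  rw [le_div_iff₀ (alphaSeq_pos h n)]; linarith [alphaSeq_lt_half h n])

theorem half_log_le_bigM_seq {α : ℝ} (h : Irrational α) (β : ℝ) (n : ℕ) :
    1 / 2 * Real.log (1 / alphaSeq α n) ≤ bigM (alphaSeq α n) (betaSeq α β n) :=
  half_log_le_bigM (alphaSeq_pos h n) (alphaSeq_lt_half h n).le (betaSeq_nonneg α β n)
    (betaSeq_le_half α β n)

theorem brjunoTerm_nonneg {α : ℝ} (h : Irrational α) (β : ℝ) (m k : ℕ) :
    0 ≤ brjunoTerm α β m k :=
  mul_nonneg (Finset.prod_nonneg fun _ _ => (alphaSeq_pos h _).le)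
    (by linarith [half_log_le_bigM_seq h β (m + k), log_one_div_alphaSeq_nonneg h (m + k)])

theorem modBrjunoSum_seq {α : ℝ} (h : Irrational α) (β : ℝ) (m : ℕ) :
    modBrjunoSum (alphaSeq α m) (betaSeq α β m) =
      ∑' k, ENNReal.ofReal (brjunoTerm α β m k) := by
  simp only [modBrjunoSum, brjunoTerm, alphaSeq_alphaSeq h, betaSeq_alphaSeq_betaSeq h]

theorem modBrjunoSum_eq (α β : ℝ) :
    modBrjunoSum α β = ∑' k, ENNReal.ofReal (brjunoTerm α β 0 k) := by
  simp only [modBrjunoSum, brjunoTerm, zero_add]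

/-- Consecutive levels differ by a finite first term and a positive finite factor. -/
theorem tsum_brjunoTerm_eq_top_iff {α : ℝ} (h : Irrational α) (β : ℝ) (m : ℕ) :
    ∑' k, ENNReal.ofReal (brjunoTerm α β m k) = ⊤ ↔
      ∑' k, ENNReal.ofReal (brjunoTerm α β 0 k) = ⊤ := by
  induction m with
  | zero => rfl
  | succ m ih =>
    rw [← ih, tsum_eq_zero_add' (f := fun k => ENNReal.ofReal (brjunoTerm α β m k))
      ENNReal.summable]
    simp only [brjunoTerm_succ, ENNReal.ofReal_mul (alphaSeq_pos h m).le, ENNReal.tsum_mul_left]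
    rw [ENNReal.add_eq_top, ENNReal.mul_eq_top]
    have := alphaSeq_pos h m
    simp [this]

/-- Termwise comparison gives 𝓑(α, β) ≤ 𝓑(α) ≤ 2𝓑(α, β). -/
theorem modBrjunoSum_eq_top_iff {α : ℝ} (h : Irrational α) (β : ℝ) :
    modBrjunoSum α β = ⊤ ↔ ¬ IsBrjuno α := by
  have hp : ∀ n, 0 ≤ ∏ i ∈ Finset.range n, alphaSeq α i :=
    fun n => Finset.prod_nonneg fun _ _ => (alphaSeq_pos h _).le
  have h1 : modBrjunoSum α β ≤ brjunoSum α := ENNReal.tsum_le_tsum fun n =>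
    ENNReal.ofReal_le_ofReal (mul_le_mul_of_nonneg_left
      (bigM_le_log (alphaSeq_pos h n) (betaSeq_nonneg α β n)) (hp n))
  have h2 : brjunoSum α ≤ 2 * modBrjunoSum α β := by
    unfold brjunoSum modBrjunoSum
    rw [← ENNReal.tsum_mul_left]
    refine ENNReal.tsum_le_tsum fun n => ?_
    rw [← ENNReal.ofReal_ofNat, ← ENNReal.ofReal_mul zero_le_two]
    refine ENNReal.ofReal_le_ofReal ?_
    have := mul_le_mul_of_nonneg_left (half_log_le_bigM_seq h β n) (hp n)
    linarith
  rw [IsBrjuno, not_lt, top_le_iff]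
  constructor
  · exact fun e => top_le_iff.1 (e ▸ h1)
  · intro e
    rw [e, top_le_iff, ENNReal.mul_eq_top] at h2
    simpa using h2

/-! ### Induction over the levels -/

/-- The level sets reach down, over every point of the base, to the height given by the partial
sums of the modified Brjuno sum, and over some point they do not go below that height, up to a
universal constant. -/
theorem exists_levelSet_estimates : ∃ K : ℝ, ∀ α β : ℝ, Irrational α → ∀ j m : ℕ,
    (∀ x ∈ Icc 0 (width α m), ∃ y : ℝ, (x : ℂ) + y * I ∈ levelSet α β j m ∧
      y ≤ (∑ k ∈ Finset.range j, brjunoTerm α β m k) / (2 * Real.pi) + K) ∧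
    ∃ x ∈ Ioo 0 (width α m), ∀ y : ℝ, (x : ℂ) + y * I ∈ levelSet α β j m →
      (∑ k ∈ Finset.range j, brjunoTerm α β m k) / (2 * Real.pi) - K ≤ y := by
  obtain ⟨C, hC0, hC⟩ := exists_Yside_im_estimates
  -- K = 2C + 1 satisfies rK + C ≤ K for r < 1/2, covers the initial height -1, and leaves K - C = C
  -- + 1 for the low case below.
  refine ⟨2 * C + 1, fun α β h j => ?_⟩
  induction j with
  | zero =>
    intro m
    have hw := one_le_width h m
    refine ⟨fun x hx => ⟨-1, ?_, ?_⟩, width α m / 2, ⟨by linarith, by linarith⟩, fun y hy => ?_⟩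
    · simpa [levelSet] using hx
    · simp; linarith
    · have := hy.2
      simp at this
      simp
      linarith
  | succ j ih =>
    intro m
    have hr := alphaSeq_pos h m
    have hr' := alphaSeq_lt_half h m
    obtain ⟨hU, hL, x₀, hx₀, hx₀', hG⟩ := hC _ _ hr hr' (betaSeq_nonneg α β m)
      (betaSeq_le_half α β m) (decide (epsSeq α m = deltaSeq α β m))
    simp only [← Yn_im] at hU hL hG
    obtain ⟨ihU, x₁, hx₁, ihL⟩ := ih (m + 1)
    have hT0 : 0 ≤ (∑ k ∈ Finset.range j, brjunoTerm α β (m + 1) k) / (2 * Real.pi) :=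
      div_nonneg (Finset.sum_nonneg fun k _ => brjunoTerm_nonneg h β _ k) (by positivity)
    rw [sum_brjunoTerm_succ, add_div, mul_div_assoc]
    set T := (∑ k ∈ Finset.range j, brjunoTerm α β (m + 1) k) / (2 * Real.pi)
    have hrK : alphaSeq α m * (2 * C + 1) ≤ C + 1 / 2 := by nlinarith
    constructor
    · intro x hx
      obtain ⟨x', hx', hmem⟩ := exists_forall_Yn_mem h β j m hx
      obtain ⟨y, hy, hyT⟩ := ihU x' hx'
      refine ⟨_, hmem _ hy (by simp), (hU _).trans ?_⟩
      have hm : max ((x' : ℂ) + y * I).im 0 ≤ T + (2 * C + 1) := by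
        simp only [add_im, ofReal_im, mul_im, ofReal_re, I_re, I_im, mul_one, mul_zero, add_zero,
          zero_add]
        exact max_le hyT (by linarith)
      have := mul_le_mul_of_nonneg_left hm hr.le
      rw [mul_add] at this
      linarith
    · rcases le_or_gt (1 / 2) (alphaSeq α m * (T - (2 * C + 1))) with hc | hc
      · obtain ⟨x, hx, hxy⟩ := exists_forall_mem_eq_Yn_im h β j m hx₁
        refine ⟨x, hx, fun y hy => ?_⟩
        obtain ⟨w, hw, hw1, rfl⟩ := hxy y hy
        have hle := ihL w.im (by rwa [← hw1, re_add_im])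
        have h1 := mul_le_mul_of_nonneg_left hle hr.le
        have := hL w (hc.trans h1)
        rw [mul_sub] at h1
        linarith
      -- Low case: rT < 1/2 + rK ≤ C + 1, so the contribution of the next level fits in the error
      -- and the good vertical line suffices.
      · obtain ⟨x, hx, hxy⟩ := exists_forall_mem_eq_Yn_im h β j m (x' := x₀) ⟨hx₀, hx₀'⟩
        refine ⟨x, hx, fun y hy => ?_⟩
        obtain ⟨w, hw, hw1, rfl⟩ := hxy y hy
        have := hG w hw1
        rw [mul_sub] at hc
        linarith

/-! ### Passage to the supremum and conclusion -/

/-- The extremal point may vary with j, which is harmless because the supremum is also over x. -/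
theorem exists_supBase_estimates : ∃ K : ℝ, ∀ α β : ℝ, Irrational α → ∀ m : ℕ,
    (∀ B : ℝ, (∀ j, ∑ k ∈ Finset.range j, brjunoTerm α β m k ≤ B) →
      supBase α β m ≤ ((B / (2 * Real.pi) + K : ℝ) : EReal)) ∧
    ∀ j, (((∑ k ∈ Finset.range j, brjunoTerm α β m k) / (2 * Real.pi) - K : ℝ) : EReal) ≤
      supBase α β m := by
  obtain ⟨K, hK⟩ := exists_levelSet_estimates
  refine ⟨K, fun α β h m => ⟨fun B hB => ?_, fun j => ?_⟩⟩
  · refine iSup₂_le fun x hx => iSup_le fun j => ?_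
    obtain ⟨y, hy, hyB⟩ := (hK α β h j m).1 x hx
    refine (sInf_le (mem_image_of_mem (fun y : ℝ => (y : EReal)) hy)).trans (EReal.coe_le_coe_iff.2 (hyB.trans ?_))
    gcongr
    exact hB j
  · obtain ⟨x, hx, hxy⟩ := (hK α β h j m).2
    refine le_trans ?_ (le_iSup₂_of_le x (Ioo_subset_Icc_self hx)
      (le_iSup (fun j => baseFunApprox α β j m x) j))
    refine le_sInf ?_
    rintro _ ⟨y, hy, rfl⟩
    exact EReal.coe_le_coe_iff.2 (hxy y hy)

end BiCritical

theorem mainTheorem5 :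
    ∃ C : ℝ, ∀ α β : ℝ, Irrational α →
      -- the uniform estimate at all levels, for Brjuno `α`
      (BiCritical.IsBrjuno α → ∀ m : ℕ, ∃ B S : ℝ,
        BiCritical.modBrjunoSum (BiCritical.alphaSeq α m) (BiCritical.betaSeq α β m)
          = ENNReal.ofReal B ∧ 0 ≤ B ∧
        BiCritical.supBase α β m = (S : EReal) ∧
        |B - 2 * Real.pi * S| ≤ C) ∧
      -- at each level, the base function is unbounded exactly when the modified sum is infinite
      (∀ m : ℕ, BiCritical.supBase α β m = ⊤ ↔
        BiCritical.modBrjunoSum (BiCritical.alphaSeq α m) (BiCritical.betaSeq α β m) = ⊤) ∧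
      (∀ m : ℕ, BiCritical.supBase α β m = ⊤ ↔ BiCritical.modBrjunoSum α β = ⊤) ∧
      -- which happens exactly when `α` is not Brjuno
      (BiCritical.modBrjunoSum α β = ⊤ ↔ ¬ BiCritical.IsBrjuno α) := by
  open BiCritical in
  obtain ⟨K, hK⟩ := exists_supBase_estimates
  refine ⟨2 * Real.pi * K, fun α β h => ?_⟩
  have hπ := Real.pi_pos
  have hmod : ∀ m, modBrjunoSum (alphaSeq α m) (betaSeq α β m) = ⊤ ↔ modBrjunoSum α β = ⊤ :=
    fun m => by rw [modBrjunoSum_seq h, modBrjunoSum_eq, tsum_brjunoTerm_eq_top_iff h]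
  have hfin : ∀ m, modBrjunoSum (alphaSeq α m) (betaSeq α β m) ≠ ⊤ → ∃ B S : ℝ,
      modBrjunoSum (alphaSeq α m) (betaSeq α β m) = ENNReal.ofReal B ∧ 0 ≤ B ∧
        supBase α β m = (S : EReal) ∧ |B - 2 * Real.pi * S| ≤ 2 * Real.pi * K := by
    intro m hm
    rw [modBrjunoSum_seq h] at hm ⊢
    have hnn := brjunoTerm_nonneg h β m
    have hs : Summable (brjunoTerm α β m) := by
      have := ENNReal.summable_toReal hm
      simpa only [ENNReal.toReal_ofReal (hnn _)] using this
    obtain ⟨hU, hL⟩ := hK α β h m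
    have hU' := hU (∑' k, brjunoTerm α β m k) fun j => hs.sum_le_tsum _ fun k _ => hnn k
    have hL0 := hL 0
    -- The upper bound excludes ⊤, and the lower bound at j = 0 excludes ⊥.
    have hS : supBase α β m = ((supBase α β m).toReal : EReal) :=
      (EReal.coe_toReal (fun e => by rw [e] at hU'; exact (EReal.coe_lt_top _).not_ge hU')
        (fun e => by rw [e] at hL0; exact (EReal.bot_lt_coe _).not_ge hL0)).symm
    refine ⟨∑' k, brjunoTerm α β m k, (supBase α β m).toReal,
      (ENNReal.ofReal_tsum_of_nonneg hnn hs).symm, tsum_nonneg hnn, hS, ?_⟩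
    rw [hS, EReal.coe_le_coe_iff] at hU'
    have hL' : ∑' k, brjunoTerm α β m k ≤ 2 * Real.pi * ((supBase α β m).toReal + K) := by
      refine hs.tsum_le_of_sum_range_le fun j => ?_
      have := hL j
      rw [hS, EReal.coe_le_coe_iff, sub_le_iff_le_add, div_le_iff₀ (by positivity)] at this
      linarith
    rw [← sub_le_iff_le_add, le_div_iff₀ (by positivity)] at hU'
    rw [abs_le]
    constructor <;> linarith
  have htop : ∀ m, supBase α β m = ⊤ ↔
      modBrjunoSum (alphaSeq α m) (betaSeq α β m) = ⊤ := by
    intro m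
    constructor
    · intro e
      by_contra hm
      obtain ⟨B, S, -, -, hS, -⟩ := hfin m hm
      rw [e] at hS
      exact EReal.coe_ne_top S hS.symm
    · intro e
      by_contra hne
      -- A real bound M on the supremum bounds all partial sums, which makes the series finite.
      obtain ⟨M, hM⟩ : ∃ M : ℝ, supBase α β m ≤ M := by
        refine ⟨(supBase α β m).toReal, EReal.le_coe_toReal hne⟩
      rw [modBrjunoSum_seq h] at e
      have hnn := brjunoTerm_nonneg h β m
      have hb : ∀ j, ∑ k ∈ Finset.range j, brjunoTerm α β m k ≤ 2 * Real.pi * (M + K) := by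
        intro j
        have := ((hK α β h m).2 j).trans hM
        rw [EReal.coe_le_coe_iff, sub_le_iff_le_add, div_le_iff₀ (by positivity)] at this
        linarith
      rw [← ENNReal.ofReal_tsum_of_nonneg hnn (summable_of_sum_range_le hnn hb)] at e
      exact ENNReal.ofReal_ne_top e
  refine ⟨fun hB m => hfin m fun e => ?_, htop, fun m => (htop m).trans (hmod m),
    modBrjunoSum_eq_top_iff h β⟩
  exact (modBrjunoSum_eq_top_iff h β).1 ((hmod m).1 e) hB
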